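/- Let $(\Omega,\mathcal H,\hat E)$ be a sublinear expectation space: $\mathcal H$ is a linear space of real functions on $\Omega$ that contains the constants, is closed under $X\mapsto|X|$, and satisfies $\varphi(X_1,\dots,X_n)\in\mathcal H$ for all $X_1,\dots,X_n\in\mathcal H$ and $\varphi\in C_{l,Lip}(\mathbb R^n)$, the space of functions with $|\varphi(x)-\varphi(y)|\le C(1+|x|^m+|y|^m)|x-y|$ for some $C>0$, $m\in\mathbb N$; and $\hat E:\mathcal H\to\mathbb R$ is monotone, constant preserving, sub-additive and positively homogeneous. Let $\{Y_i\}_{i\ge1}$ be $\mathbb R^d$-valued random variables (all coordinates in $\mathcal H$) such that (i) each $Y_{i+1}$ is independent from $(Y_1,\dots,Y_i)$, that is, for all $\varphi\in C_{l,Lip}(\mathbb R^{(i+1)d})$, $$\hat E[\varphi(Y_1,\dots,Y_i,Y_{i+1})]=\hat E\big[\hat E[\varphi(x,Y_{i+1})]\big|_{x=(Y_1,\dots,Y_i)}\big],\qquad i=1,2,\dots;$$ (ii) there is a constant $M>0$ with $\hat E[|Y_i|^2]\le M$ for all $i$; (v) there are bounded, convex and closed sets $\Gamma_i\subset\mathbb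 R^d$ with $\hat E[\langle Y_i,p\rangle]=\sup_{q\in\Gamma_i}\langle q,p\rangle$ for all $p\in\mathbb R^d$, and a nonempty bounded, convex and closed set $\Gamma\subset\mathbb R^d$ such that $$\lim_{n\to\infty}\frac1n\sum_{i=1}^n d_H(\Gamma_i,\Gamma)=0,$$ where $d_H$ is the Hausdorff distance. Call a $d$-dimensional random vector $\eta$ on a sublinear expectation space $(\Omega',\mathcal H',\hat E')$ maximal distributed over $\Gamma$ if $\hat E'[\varphi(\eta)]=\max_{y\in\Gamma}\varphi(y)$ for every bounded Lipschitz $\varphi:\mathbb R^d\to\mathbb R$. Then such an $\eta$ exists on some sublinear expectation space, and with $S_n=Y_1+\cdots+Y_n$ the sequence $S_n/n$ converges in law to the maximal distribution over $\Gamma$: for every such $\eta$, $$\lim_{n\to\infty}\hat E\Big[\varphi\Big(\frac{S_n}{n}\Big)\Big]=\hat E'[\varphi(\eta)]\qquad\text{for all bounded Lipschitz }\varphi:\mathbb R^d\to\mathbb R.$$ -/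

import Mathlib

/-- `C_{l,Lip}(V)`: the functions with
`|φ x - φ y| ≤ C (1 + |x|^m + |y|^m) |x - y|` for some `C > 0` and `m ∈ ℕ`.
On a finite-dimensional `V` equivalent norms give the same class (only `C` changes), so `ℝ^(a+b)`
may be written as a product and `ℝ^(k*d)` as `Fin k → ℝ^d`. -/
def IsPolyLip {V : Type*} [NormedAddCommGroup V] (φ : V → ℝ) : Prop :=
  ∃ C : ℝ, 0 < C ∧ ∃ m : ℕ, ∀ x y : V,
    |φ x - φ y| ≤ C * (1 + ‖x‖ ^ m + ‖y‖ ^ m) * ‖x - y‖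

/-- `C_{b,Lip}(V)`: the bounded Lipschitz functions. -/
def IsBddLip {V : Type*} [NormedAddCommGroup V] (φ : V → ℝ) : Prop :=
  (∃ B : ℝ, ∀ x, |φ x| ≤ B) ∧ ∃ K : NNReal, LipschitzWith K φ

/-- A sublinear expectation space `(Ω, H, E)`. -/
structure SublinearExpectationSpace (Ω : Type*) where
  /-- The linear space of random variables. -/
  H : Submodule ℝ (Ω → ℝ)
  const_mem : ∀ c : ℝ, (fun _ => c) ∈ H
  abs_mem : ∀ X ∈ H, (fun ω => |X ω|) ∈ H
  comp_mem : ∀ (n : ℕ) (X : Fin n → Ω → ℝ), (∀ k, X k ∈ H) →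
    ∀ φ : EuclideanSpace ℝ (Fin n) → ℝ, IsPolyLip φ →
      (fun ω => φ (WithLp.toLp 2 fun k => X k ω)) ∈ H
  /-- The sublinear expectation. -/
  E : H → ℝ
  mono : ∀ X Y : H, (∀ ω, (Y : Ω → ℝ) ω ≤ (X : Ω → ℝ) ω) → E Y ≤ E X
  const_preserving : ∀ c : ℝ, E ⟨fun _ => c, const_mem c⟩ = c
  subadditive : ∀ X Y : H, E (X + Y) ≤ E X + E Y
  pos_homogeneous : ∀ (r : ℝ) (X : H), 0 ≤ r → E (r • X) = r * E X

namespace SublinearExpectationSpace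

variable {Ω : Type*}

open Classical in
/-- The expectation of a random variable, written without the proof of membership in `H`.
It is the sublinear expectation on `H`; the value `0` off `H` is never used: everything it is
applied to below is a function in `C_{l,Lip}` of finitely many elements of `H`. -/
noncomputable def expect (S : SublinearExpectationSpace Ω) (X : Ω → ℝ) : ℝ :=
  if h : X ∈ S.H then S.E ⟨X, h⟩ else 0

/-- An `ℝ^d`-valued random variable: all coordinates belong to `H`. -/
def IsRandomVector (S : SublinearExpectationSpace Ω) {d : ℕ}
    (X : Ω → EuclideanSpace ℝ (Fin d)) : Prop :=
  ∀ j, (fun ω => X ω j) ∈ S.H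

/-- The random vector `Y` is independent from the random vector `X`:
`E[φ(X, Y)] = E[E[φ(x, Y)]|_{x = X}]` for all `φ ∈ C_{l,Lip}`. The map `x ↦ E[φ(x, Y)]` is again
in `C_{l,Lip}`, so the outer expectation is that of an element of `H`. -/
def IndepFrom (S : SublinearExpectationSpace Ω) {V W : Type*}
    [NormedAddCommGroup V] [NormedAddCommGroup W] (Y : Ω → W) (X : Ω → V) : Prop :=
  ∀ φ : V × W → ℝ, IsPolyLip φ →
    S.expect (fun ω => φ (X ω, Y ω)) =
      S.expect (fun ω => S.expect (fun ω' => φ (X ω, Y ω')))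

/-- `η` is maximal distributed over the bounded, convex and closed set `Γ`:
`E[φ(η)] = max_{y ∈ Γ} φ(y)` for all `φ ∈ C_{b,Lip}(ℝ^d)`. -/
def IsMaximalDistributed (S : SublinearExpectationSpace Ω) {d : ℕ}
    (η : Ω → EuclideanSpace ℝ (Fin d)) (Γ : Set (EuclideanSpace ℝ (Fin d))) : Prop :=
  S.IsRandomVector η ∧ Bornology.IsBounded Γ ∧ Convex ℝ Γ ∧ IsClosed Γ ∧
    ∀ φ : EuclideanSpace ℝ (Fin d) → ℝ, IsBddLip φ →
      IsGreatest (φ '' Γ) (S.expect fun ω => φ (η ω))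

end SublinearExpectationSpace

/-! A direct second-moment argument gives the law of large numbers with a rate. Two quadratic
functionals of `S_k` are followed: the squared distance to `kΓ`, whose upper expectation must stay
small, and `-‖S_k - k y‖²` for a maximizer `y` of `φ` over `Γ`, whose expectation must not be too
negative. The first says that every scenario keeps `S_n / n` near `Γ`, the second that some scenario
brings it near `y`.

Expanding the square, one summand adds a bounded second-moment term and a linear term. The mean set
`Γ_k` controls the linear term, up to `d_H(Γ_k, Γ)` times a length that is `O(k)` on average
(`expect_infDist_sq_le`, `le_expect_neg_norm_sub_sq`). Independence iterates these steps, with total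
error `O(n) + O(n) ∑ d_H(Γ_k, Γ) = o(n²)`. `abs_expect_sub_isGreatest_le` converts this into
convergence for Lipschitz `φ`. -/

/-- Functions whose increments are controlled by `C (1 + ‖x‖ + ‖y‖) ‖x - y‖`, such as squares of
Lipschitz functions. -/
def IsQuadLip {V : Type*} [NormedAddCommGroup V] (f : V → ℝ) : Prop :=
  ∃ C : ℝ, 0 < C ∧ ∀ x y : V, |f x - f y| ≤ C * (1 + ‖x‖ + ‖y‖) * ‖x - y‖

/-! ### Stability of the class of quadratic growth -/

namespace IsQuadLip

variable {V W : Type*} [NormedAddCommGroup V] [NormedAddCommGroup W]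

theorem isPolyLip {f : V → ℝ} (hf : IsQuadLip f) : IsPolyLip f := by
  obtain ⟨C, hC, h⟩ := hf
  exact ⟨C, hC, 1, by simpa using h⟩

theorem of_abs_sub_le {f : V → ℝ} {K : ℝ} (h : ∀ x y, |f x - f y| ≤ K * ‖x - y‖) :
    IsQuadLip f := by
  refine ⟨|K| + 1, by positivity, fun x y => (h x y).trans ?_⟩
  gcongr
  nlinarith [abs_nonneg K, le_abs_self K, norm_nonneg x, norm_nonneg y,
    mul_nonneg (abs_nonneg K) (norm_nonneg x), mul_nonneg (abs_nonneg K) (norm_nonneg y)]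

theorem neg {f : V → ℝ} (hf : IsQuadLip f) : IsQuadLip fun x => -f x := by
  obtain ⟨C, hC, h⟩ := hf
  refine ⟨C, hC, fun x y => ?_⟩
  have : -f x - -f y = -(f x - f y) := by ring
  rw [this, abs_neg]
  exact h x y

theorem sq_of_abs_sub_le {g : V → ℝ} (h : ∀ x y, |g x - g y| ≤ ‖x - y‖) :
    IsQuadLip fun x => g x ^ 2 := by
  have hg : ∀ x, |g x| ≤ |g 0| + ‖x‖ := fun x => by
    have h1 := h x 0
    rw [sub_zero] at h1
    have h2 := abs_sub_abs_le_abs_sub (g x) (g 0)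
    linarith
  refine ⟨2 * |g 0| + 1, by positivity, fun x y => ?_⟩
  have h1 : g x ^ 2 - g y ^ 2 = (g x + g y) * (g x - g y) := by ring
  rw [h1, abs_mul]
  have h2 : |g x + g y| ≤ (2 * |g 0| + 1) * (1 + ‖x‖ + ‖y‖) := by
    have h3 := abs_add_le (g x) (g y)
    have h4 := hg x
    have h5 := hg y
    nlinarith [mul_nonneg (abs_nonneg (g 0)) (norm_nonneg x),
      mul_nonneg (abs_nonneg (g 0)) (norm_nonneg y)]
  exact mul_le_mul h2 (h x y) (abs_nonneg _) (by positivity)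

/-- Precomposition with an additive map that is bounded. -/
theorem comp_addMonoidHom {f : W → ℝ} (hf : IsQuadLip f) (L : V →+ W) {K : ℝ} (hK : 1 ≤ K)
    (hL : ∀ x, ‖L x‖ ≤ K * ‖x‖) : IsQuadLip fun x => f (L x) := by
  obtain ⟨C, hC, h⟩ := hf
  refine ⟨C * K * K, by positivity, fun x y => (h _ _).trans ?_⟩
  have h1 : ‖L x - L y‖ ≤ K * ‖x - y‖ := by rw [← map_sub]; exact hL _
  have h2 : 1 + ‖L x‖ + ‖L y‖ ≤ K * (1 + ‖x‖ + ‖y‖) := by linarith [hL x, hL y]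
  calc C * (1 + ‖L x‖ + ‖L y‖) * ‖L x - L y‖
      ≤ C * (K * (1 + ‖x‖ + ‖y‖)) * (K * ‖x - y‖) := by gcongr
    _ = _ := by ring

theorem comp_add_left {f : V → ℝ} (hf : IsQuadLip f) (a : V) : IsQuadLip fun x => f (a + x) := by
  obtain ⟨C, hC, h⟩ := hf
  refine ⟨C * (1 + 2 * ‖a‖), by positivity, fun x y => (h _ _).trans ?_⟩
  rw [add_sub_add_left_eq_sub]
  have h2 : 1 + ‖a + x‖ + ‖a + y‖ ≤ (1 + 2 * ‖a‖) * (1 + ‖x‖ + ‖y‖) := by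
    nlinarith [norm_add_le a x, norm_add_le a y, mul_nonneg (norm_nonneg a) (norm_nonneg x),
      mul_nonneg (norm_nonneg a) (norm_nonneg y)]
  calc C * (1 + ‖a + x‖ + ‖a + y‖) * ‖x - y‖
      ≤ C * ((1 + 2 * ‖a‖) * (1 + ‖x‖ + ‖y‖)) * ‖x - y‖ := by gcongr
    _ = _ := by ring

theorem norm : IsQuadLip fun x : V => ‖x‖ :=
  of_abs_sub_le (K := 1) fun x y => by simpa using abs_norm_sub_norm_le x y

theorem norm_sub_sq (c : V) : IsQuadLip fun x : V => ‖x - c‖ ^ 2 :=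
  sq_of_abs_sub_le fun x y => by simpa using abs_norm_sub_norm_le (x - c) (y - c)

theorem norm_sq : IsQuadLip fun x : V => ‖x‖ ^ 2 := by simpa using norm_sub_sq (0 : V)

theorem infDist_sq (s : Set V) : IsQuadLip fun x : V => Metric.infDist x s ^ 2 :=
  sq_of_abs_sub_le fun x y => by
    have := (Metric.lipschitz_infDist_pt s).dist_le_mul x y
    simpa [Real.dist_eq, dist_eq_norm] using this

theorem inner_left {d : ℕ} (p : EuclideanSpace ℝ (Fin d)) :
    IsQuadLip fun x : EuclideanSpace ℝ (Fin d) => inner ℝ x p :=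
  of_abs_sub_le (K := ‖p‖) fun x y => by
    rw [← inner_sub_left, mul_comm]
    exact abs_real_inner_le_norm _ _

end IsQuadLip

/-! ### Calculus of sublinear expectations and partial sums -/

namespace SublinearExpectationSpace

variable {Ω : Type*} (S : SublinearExpectationSpace Ω) {d : ℕ}

theorem expect_of_mem {X : Ω → ℝ} (hX : X ∈ S.H) : S.expect X = S.E ⟨X, hX⟩ := dif_pos hX

theorem expect_mono {X Y : Ω → ℝ} (hX : X ∈ S.H) (hY : Y ∈ S.H) (h : ∀ ω, X ω ≤ Y ω) :
    S.expect X ≤ S.expect Y := by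
  rw [S.expect_of_mem hX, S.expect_of_mem hY]
  exact S.mono _ _ h

theorem expect_const (c : ℝ) : S.expect (fun _ => c) = c := by
  rw [S.expect_of_mem (S.const_mem c)]
  exact S.const_preserving c

theorem add_mem {X Y : Ω → ℝ} (hX : X ∈ S.H) (hY : Y ∈ S.H) : (fun ω => X ω + Y ω) ∈ S.H :=
  S.H.add_mem hX hY

theorem neg_mem {X : Ω → ℝ} (hX : X ∈ S.H) : (fun ω => -X ω) ∈ S.H :=
  S.H.neg_mem hX

theorem const_mul_mem (c : ℝ) {X : Ω → ℝ} (hX : X ∈ S.H) : (fun ω => c * X ω) ∈ S.H :=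
  S.H.smul_mem c hX

theorem expect_add_le {X Y : Ω → ℝ} (hX : X ∈ S.H) (hY : Y ∈ S.H) :
    S.expect (fun ω => X ω + Y ω) ≤ S.expect X + S.expect Y := by
  rw [S.expect_of_mem hX, S.expect_of_mem hY, S.expect_of_mem (S.add_mem hX hY)]
  exact S.subadditive ⟨X, hX⟩ ⟨Y, hY⟩

theorem expect_const_mul {c : ℝ} (hc : 0 ≤ c) {X : Ω → ℝ} (hX : X ∈ S.H) :
    S.expect (fun ω => c * X ω) = c * S.expect X := by
  rw [S.expect_of_mem hX, S.expect_of_mem (S.const_mul_mem c hX)]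
  exact S.pos_homogeneous c ⟨X, hX⟩ hc

theorem affine_mem (c r : ℝ) {X : Ω → ℝ} (hX : X ∈ S.H) : (fun ω => c + r * X ω) ∈ S.H :=
  S.add_mem (S.const_mem c) (S.const_mul_mem r hX)

theorem expect_affine_le (c : ℝ) {r : ℝ} (hr : 0 ≤ r) {X : Ω → ℝ} (hX : X ∈ S.H) :
    S.expect (fun ω => c + r * X ω) ≤ c + r * S.expect X := by
  have h := S.expect_add_le (S.const_mem c) (S.const_mul_mem r hX)
  rwa [S.expect_const, S.expect_const_mul hr hX] at h

/-- Subadditivity applied to `rX = -c + (c + rX)`; constants therefore pass through the expectation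
exactly. -/
theorem le_expect_affine (c : ℝ) {r : ℝ} (hr : 0 ≤ r) {X : Ω → ℝ} (hX : X ∈ S.H) :
    c + r * S.expect X ≤ S.expect (fun ω => c + r * X ω) := by
  have h := S.expect_add_le (S.const_mem (-c)) (S.affine_mem c r hX)
  simp only [neg_add_cancel_left] at h
  rw [S.expect_const, S.expect_const_mul hr hX] at h
  linarith

/-- Moving a bound on increments through the expectation. -/
theorem abs_expect_sub_le {X Y Z : Ω → ℝ} (hX : X ∈ S.H) (hY : Y ∈ S.H) (hZ : Z ∈ S.H)
    (h : ∀ ω, |X ω - Y ω| ≤ Z ω) : |S.expect X - S.expect Y| ≤ S.expect Z := by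
  have h1 := (S.expect_mono hX (S.add_mem hY hZ)
    fun ω => by linarith [(abs_le.1 (h ω)).2]).trans (S.expect_add_le hY hZ)
  have h2 := (S.expect_mono hY (S.add_mem hX hZ)
    fun ω => by linarith [(abs_le.1 (h ω)).1]).trans (S.expect_add_le hX hZ)
  rw [abs_le]
  constructor <;> linarith

variable {S}

theorem IsRandomVector.comp_mem {X : Ω → EuclideanSpace ℝ (Fin d)} (hX : S.IsRandomVector X)
    {f : EuclideanSpace ℝ (Fin d) → ℝ} (hf : IsQuadLip f) : (fun ω => f (X ω)) ∈ S.H :=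
  S.comp_mem d (fun k ω => X ω k) hX f hf.isPolyLip

theorem IsRandomVector.sum {Y : ℕ → Ω → EuclideanSpace ℝ (Fin d)}
    (hY : ∀ i, S.IsRandomVector (Y i)) (n : ℕ) :
    S.IsRandomVector fun ω => ∑ i ∈ Finset.range n, Y i ω := by
  intro j
  have : (fun ω => (∑ i ∈ Finset.range n, Y i ω) j) = ∑ i ∈ Finset.range n, fun ω => Y i ω j := by
    ext ω
    simp
  rw [this]
  exact S.H.sum_mem fun i _ => hY i j

/-- Averaging over a random translation preserves the class `IsQuadLip`. -/
theorem IsRandomVector.isQuadLip_expect_add {X : Ω → EuclideanSpace ℝ (Fin d)}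
    (hX : S.IsRandomVector X) {f : EuclideanSpace ℝ (Fin d) → ℝ} (hf : IsQuadLip f) :
    IsQuadLip fun a => S.expect fun ω => f (a + X ω) := by
  have hmem := fun a => hX.comp_mem (hf.comp_add_left a)
  obtain ⟨C, hC, h⟩ := hf
  have hN := hX.comp_mem IsQuadLip.norm
  have hN0 : 0 ≤ S.expect fun ω => ‖X ω‖ := by
    have := S.expect_mono (S.const_mem 0) hN fun ω => norm_nonneg _
    rwa [S.expect_const] at this
  set m := S.expect fun ω => ‖X ω‖
  refine ⟨C * (1 + 2 * m), by positivity, fun a b => ?_⟩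
  -- The random shift cancels in the difference, so only the first moment `m` of `X` enters the
  -- constant.
  have key := S.abs_expect_sub_le (hmem a) (hmem b)
    (S.affine_mem (C * (1 + ‖a‖ + ‖b‖) * ‖a - b‖) (2 * C * ‖a - b‖) hN) fun ω => by
      refine (h _ _).trans ?_
      rw [add_sub_add_right_eq_sub]
      calc C * (1 + ‖a + X ω‖ + ‖b + X ω‖) * ‖a - b‖
          ≤ C * (1 + (‖a‖ + ‖X ω‖) + (‖b‖ + ‖X ω‖)) * ‖a - b‖ := by
            gcongr <;> exact norm_add_le _ _
        _ = _ := by ring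
  refine (key.trans (S.expect_affine_le _ (by positivity) hN)).trans ?_
  have : 0 ≤ C * ‖a - b‖ * m * (‖a‖ + ‖b‖) := by positivity
  change C * (1 + ‖a‖ + ‖b‖) * ‖a - b‖ + 2 * C * ‖a - b‖ * m ≤ _
  nlinarith

/-- The tower property for partial sums of an independent sequence. -/
theorem expect_sum_succ {Y : ℕ → Ω → EuclideanSpace ℝ (Fin d)}
    (hindep : ∀ i : ℕ, S.IndepFrom (Y (i + 1)) (fun ω (k : Fin (i + 1)) => Y k ω))
    {f : EuclideanSpace ℝ (Fin d) → ℝ} (hf : IsQuadLip f) (n : ℕ) :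
    S.expect (fun ω => f (∑ i ∈ Finset.range (n + 1), Y i ω)) =
      S.expect fun ω => S.expect fun ω' => f (∑ i ∈ Finset.range n, Y i ω + Y n ω') := by
  cases n with
  -- The empty sum is constant, so the first step needs no independence.
  | zero => simp [S.expect_const]
  | succ n =>
    let L : (Fin (n + 1) → EuclideanSpace ℝ (Fin d)) × EuclideanSpace ℝ (Fin d) →+
        EuclideanSpace ℝ (Fin d) :=
      { toFun := fun x => ∑ k, x.1 k + x.2
        map_zero' := by simp
        map_add' := fun x y => by
          simp only [Prod.fst_add, Prod.snd_add, Pi.add_apply, Finset.sum_add_distrib]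
          abel }
    have hL : ∀ x, ‖L x‖ ≤ ((n : ℝ) + 2) * ‖x‖ := fun x => by
      have h1 : ‖∑ k, x.1 k‖ ≤ ((n : ℝ) + 1) * ‖x‖ := by
        refine (norm_sum_le_of_le _ (f := x.1) (n := fun _ => ‖x‖) fun k _ =>
          (norm_le_pi_norm x.1 k).trans (norm_fst_le x)).trans_eq ?_
        simp
      have h2 := norm_add_le (∑ k, x.1 k) x.2
      have h3 := norm_snd_le x
      change ‖∑ k, x.1 k + x.2‖ ≤ _
      linarith
    have key := hindep n (fun x => f (L x))
      (hf.comp_addMonoidHom L (by linarith [(n.cast_nonneg : (0 : ℝ) ≤ n)]) hL).isPolyLip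
    have hs : ∀ ω, ∑ k : Fin (n + 1), Y k ω = ∑ i ∈ Finset.range (n + 1), Y i ω := fun ω =>
      Fin.sum_univ_eq_sum_range (fun i => Y i ω) (n + 1)
    simp only [L, AddMonoidHom.coe_mk, ZeroHom.coe_mk, hs] at key
    simpa only [Finset.sum_range_succ _ (n + 1)] using key

theorem expect_norm_le {X : Ω → EuclideanSpace ℝ (Fin d)} (hX : S.IsRandomVector X) {M : ℝ}
    (hM : S.expect (fun ω => ‖X ω‖ ^ 2) ≤ M) : S.expect (fun ω => ‖X ω‖) ≤ 1 + M := by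
  have h2 := hX.comp_mem IsQuadLip.norm_sq
  have := (S.expect_mono (hX.comp_mem IsQuadLip.norm) (S.affine_mem 1 1 h2) fun ω => by
    nlinarith [sq_nonneg (‖X ω‖ - 1)]).trans (S.expect_affine_le 1 zero_le_one h2)
  linarith

theorem expect_norm_sum_le {Y : ℕ → Ω → EuclideanSpace ℝ (Fin d)}
    (hY : ∀ i, S.IsRandomVector (Y i)) {A : ℝ} (hA : ∀ i, S.expect (fun ω => ‖Y i ω‖) ≤ A)
    (n : ℕ) : S.expect (fun ω => ‖∑ i ∈ Finset.range n, Y i ω‖) ≤ n * A := by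
  induction n with
  | zero => simp [S.expect_const]
  | succ n ih =>
    have h1 := (IsRandomVector.sum hY n).comp_mem IsQuadLip.norm
    have h2 := (hY n).comp_mem IsQuadLip.norm
    have := (S.expect_mono ((IsRandomVector.sum hY (n + 1)).comp_mem IsQuadLip.norm)
      (S.add_mem h1 h2) fun ω => by
        rw [Finset.sum_range_succ]; exact norm_add_le _ _).trans (S.expect_add_le h1 h2)
    push_cast
    linarith [hA n]

/-- Iteration of a one-step upper bound along the partial sums. -/
theorem expect_sum_le_of_step {Y : ℕ → Ω → EuclideanSpace ℝ (Fin d)}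
    (hY : ∀ i, S.IsRandomVector (Y i))
    (hindep : ∀ i : ℕ, S.IndepFrom (Y (i + 1)) (fun ω (k : Fin (i + 1)) => Y k ω))
    {A : ℝ} (hA : ∀ i, S.expect (fun ω => ‖Y i ω‖) ≤ A)
    {f : ℕ → EuclideanSpace ℝ (Fin d) → ℝ} (hf : ∀ k, IsQuadLip (f k)) {b c : ℕ → ℝ}
    (hc : ∀ k, 0 ≤ c k)
    (hstep : ∀ k a, S.expect (fun ω => f (k + 1) (a + Y k ω)) ≤ f k a + (b k + c k * ‖a‖))
    (n : ℕ) : S.expect (fun ω => f n (∑ i ∈ Finset.range n, Y i ω)) ≤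
      f 0 0 + ∑ k ∈ Finset.range n, (b k + c k * (k * A)) := by
  induction n with
  | zero => simp [S.expect_const]
  | succ n ih =>
    have hS := IsRandomVector.sum hY n
    have h1 := hS.comp_mem (hf n)
    have h2 := hS.comp_mem IsQuadLip.norm
    have h3 := S.affine_mem (b n) (c n) h2
    have h4 := S.expect_mono (hS.comp_mem ((hY n).isQuadLip_expect_add (hf (n + 1))))
      (S.add_mem h1 h3) fun ω => hstep n _
    have h5 := S.expect_add_le h1 h3
    have h6 := S.expect_affine_le (b n) (hc n) h2
    -- The error linear in the current position is averaged: the mean of `‖S_n‖` is at most `n A`.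
    have h7 := mul_le_mul_of_nonneg_left (expect_norm_sum_le hY hA n) (hc n)
    rw [expect_sum_succ hindep (hf (n + 1)), Finset.sum_range_succ]
    linarith

/-- Iteration of a one-step lower bound along the partial sums. -/
theorem le_expect_sum_of_step {Y : ℕ → Ω → EuclideanSpace ℝ (Fin d)}
    (hY : ∀ i, S.IsRandomVector (Y i))
    (hindep : ∀ i : ℕ, S.IndepFrom (Y (i + 1)) (fun ω (k : Fin (i + 1)) => Y k ω))
    {A : ℝ} (hA : ∀ i, S.expect (fun ω => ‖Y i ω‖) ≤ A)
    {f : ℕ → EuclideanSpace ℝ (Fin d) → ℝ} (hf : ∀ k, IsQuadLip (f k)) {b c : ℕ → ℝ}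
    (hc : ∀ k, 0 ≤ c k)
    (hstep : ∀ k a, f k a ≤ S.expect (fun ω => f (k + 1) (a + Y k ω)) + (b k + c k * ‖a‖))
    (n : ℕ) : f 0 0 ≤ S.expect (fun ω => f n (∑ i ∈ Finset.range n, Y i ω)) +
      ∑ k ∈ Finset.range n, (b k + c k * (k * A)) := by
  induction n with
  | zero => simp [S.expect_const]
  | succ n ih =>
    have hS := IsRandomVector.sum hY n
    have h1 := hS.comp_mem ((hY n).isQuadLip_expect_add (hf (n + 1)))
    have h2 := hS.comp_mem IsQuadLip.norm
    have h3 := S.affine_mem (b n) (c n) h2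
    have h4 := S.expect_mono (hS.comp_mem (hf n)) (S.add_mem h1 h3) fun ω => hstep n _
    have h5 := S.expect_add_le h1 h3
    have h6 := S.expect_affine_le (b n) (hc n) h2
    have h7 := mul_le_mul_of_nonneg_left (expect_norm_sum_le hY hA n) (hc n)
    rw [expect_sum_succ hindep (hf (n + 1)), Finset.sum_range_succ]
    linarith

end SublinearExpectationSpace

/-! ### One-step estimates for the two quadratic functionals -/

open scoped Pointwise

theorem exists_inner_le_add_hausdorffDist {F : Type*} [NormedAddCommGroup F]
    [InnerProductSpace ℝ F] {s t : Set F} (hs : Bornology.IsBounded s) (ht : IsCompact t)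
    (ht' : t.Nonempty) {q : F} (hq : q ∈ s) (v : F) :
    ∃ q' ∈ t, inner ℝ q v ≤ inner ℝ q' v + Metric.hausdorffDist s t * ‖v‖ := by
  obtain ⟨q', hq', h⟩ := ht.exists_infDist_eq_dist ht' q
  refine ⟨q', hq', ?_⟩
  have h1 : ‖q - q'‖ ≤ Metric.hausdorffDist s t := by
    rw [← dist_eq_norm, ← h]
    exact Metric.infDist_le_hausdorffDist_of_mem hq
      -- Finiteness matters: an infinite Hausdorff distance would be read as the real number `0`.
      (Metric.hausdorffEDist_ne_top_of_nonempty_of_bounded ⟨q, hq⟩ ht' hs ht.isBounded)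
  have h2 := real_inner_le_norm (q - q') v
  rw [inner_sub_left] at h2
  linarith [mul_le_mul_of_nonneg_right h1 (norm_nonneg v)]

theorem norm_sub_sq_le_two_mul {F : Type*} [NormedAddCommGroup F] (y : F) {q : F} {R : ℝ}
    (hq : ‖q‖ ≤ R) : ‖y - q‖ ^ 2 ≤ 2 * R ^ 2 + 2 * ‖y‖ ^ 2 := by
  have h1 := norm_sub_le y q
  have h2 : ‖y - q‖ ^ 2 ≤ (‖y‖ + R) ^ 2 := by gcongr; linarith
  nlinarith [sq_nonneg (‖y‖ - R)]

namespace SublinearExpectationSpace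

variable {Ω : Type*} {S : SublinearExpectationSpace Ω} {d : ℕ}

/-- One step of the squared distance of the partial sums to the dilates of `Γ`. -/
theorem expect_infDist_sq_le {X : Ω → EuclideanSpace ℝ (Fin d)} (hX : S.IsRandomVector X)
    {M : ℝ} (hM : S.expect (fun ω => ‖X ω‖ ^ 2) ≤ M) {G Γ : Set (EuclideanSpace ℝ (Fin d))}
    (hG : Bornology.IsBounded G)
    (hGX : ∀ p, IsLUB ((fun q => inner ℝ q p) '' G) (S.expect fun ω => inner ℝ (X ω) p))
    (hne : Γ.Nonempty) (hΓ : IsCompact Γ) (hconv : Convex ℝ Γ) {R : ℝ} (hR : ∀ q ∈ Γ, ‖q‖ ≤ R)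
    (k : ℕ) (a : EuclideanSpace ℝ (Fin d)) :
    S.expect (fun ω => Metric.infDist (a + X ω) (((k + 1 : ℕ) : ℝ) • Γ) ^ 2) ≤
      Metric.infDist a ((k : ℝ) • Γ) ^ 2 +
        ((2 * R ^ 2 + 2 * M + 2 * Metric.hausdorffDist G Γ * (k * R)) +
          2 * Metric.hausdorffDist G Γ * ‖a‖) := by
  obtain ⟨p, hp, hpd⟩ := (hΓ.smul (k : ℝ)).exists_infDist_eq_dist (hne.smul_set) a
  set v := a - p with hv
  -- As `q` maximizes the pairing with `v`, the cross term `⟨X - q, v⟩` has upper expectation at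
  -- most `δ ‖v‖`.
  obtain ⟨q, hq, hqmax⟩ := hΓ.exists_isMaxOn hne
    (f := fun q => inner ℝ q v) (by fun_prop)
  have hpn : ‖p‖ ≤ k * R := by
    obtain ⟨z, hz, rfl⟩ := hp
    simp only [norm_smul, RCLike.norm_natCast]
    exact mul_le_mul_of_nonneg_left (hR z hz) k.cast_nonneg
  have hpq : p + q ∈ ((k + 1 : ℕ) : ℝ) • Γ := by
    push_cast
    -- Convexity gives `(k + 1)Γ = kΓ + Γ`, so `p + q` is an admissible competitor.
    rw [hconv.add_smul k.cast_nonneg zero_le_one, one_smul]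
    exact Set.add_mem_add hp hq
  set δ := Metric.hausdorffDist G Γ
  have hδ : 0 ≤ δ := Metric.hausdorffDist_nonneg
  have hsup : S.expect (fun ω => inner ℝ (X ω) v) ≤ inner ℝ q v + δ * ‖v‖ := by
    refine (hGX v).2 ?_
    rintro _ ⟨z, hz, rfl⟩
    obtain ⟨z', hz', h⟩ := exists_inner_le_add_hausdorffDist hG hΓ hne hz v
    have := hqmax hz'
    simp only [Set.mem_ofPred_eq] at this
    exact h.trans (by linarith)
  have hI := hX.comp_mem (IsQuadLip.inner_left v)
  have hN := hX.comp_mem IsQuadLip.norm_sq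
  have hpt : ∀ ω, Metric.infDist (a + X ω) (((k + 1 : ℕ) : ℝ) • Γ) ^ 2 ≤
      ((‖v‖ ^ 2 - 2 * inner ℝ q v + 2 * R ^ 2) + 2 * inner ℝ (X ω) v) + (0 + 2 * ‖X ω‖ ^ 2) := by
    intro ω
    have h1 : Metric.infDist (a + X ω) (((k + 1 : ℕ) : ℝ) • Γ) ≤ ‖v + (X ω - q)‖ := by
      refine (Metric.infDist_le_dist_of_mem hpq).trans_eq ?_
      rw [dist_eq_norm, hv]
      congr 1
      abel
    have h2 := pow_le_pow_left₀ Metric.infDist_nonneg h1 2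
    rw [norm_add_sq_real, inner_sub_right, real_inner_comm (X ω) v, real_inner_comm q v] at h2
    have h3 := norm_sub_sq_le_two_mul (X ω) (hR q hq)
    linarith
  have hstep := S.expect_mono (hX.comp_mem ((IsQuadLip.infDist_sq _).comp_add_left a))
    (S.add_mem (S.affine_mem _ 2 hI) (S.affine_mem 0 2 hN)) hpt
  have hadd := S.expect_add_le (S.affine_mem (‖v‖ ^ 2 - 2 * inner ℝ q v + 2 * R ^ 2) 2 hI)
    (S.affine_mem 0 2 hN)
  have h4 := S.expect_affine_le (‖v‖ ^ 2 - 2 * inner ℝ q v + 2 * R ^ 2) zero_le_two hI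
  have h5 := S.expect_affine_le 0 zero_le_two hN
  have hvn : ‖v‖ ≤ ‖a‖ + k * R := (norm_sub_le a p).trans (by linarith)
  have h6 := mul_le_mul_of_nonneg_left hvn hδ
  rw [hpd, dist_eq_norm]
  linarith

/-- One step of minus the squared distance of the partial sums to the multiples of `y ∈ Γ`. -/
theorem le_expect_neg_norm_sub_sq {X : Ω → EuclideanSpace ℝ (Fin d)} (hX : S.IsRandomVector X)
    {M : ℝ} (hM : S.expect (fun ω => ‖X ω‖ ^ 2) ≤ M) {G Γ : Set (EuclideanSpace ℝ (Fin d))}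
    (hG : IsCompact G)
    (hGX : ∀ p, IsLUB ((fun q => inner ℝ q p) '' G) (S.expect fun ω => inner ℝ (X ω) p))
    (hΓ : Bornology.IsBounded Γ) {R : ℝ} (hR : ∀ q ∈ Γ, ‖q‖ ≤ R)
    {y : EuclideanSpace ℝ (Fin d)} (hy : y ∈ Γ) (k : ℕ) (a : EuclideanSpace ℝ (Fin d)) :
    -‖a - (k : ℝ) • y‖ ^ 2 ≤
      S.expect (fun ω => -‖a + X ω - ((k + 1 : ℕ) : ℝ) • y‖ ^ 2) +
        ((2 * R ^ 2 + 2 * M + 2 * Metric.hausdorffDist G Γ * (k * R)) +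
          2 * Metric.hausdorffDist G Γ * ‖a‖) := by
  have hGne : G.Nonempty := by
    rw [Set.nonempty_iff_ne_empty]
    rintro rfl
    -- The empty set has no least upper bound in `ℝ`.
    simpa using (hGX 0).nonempty
  set v := a - (k : ℝ) • y with hv
  have hvn : ‖v‖ ≤ ‖a‖ + k * R := by
    refine (norm_sub_le _ _).trans ?_
    rw [norm_smul, RCLike.norm_natCast]
    have := mul_le_mul_of_nonneg_left (hR y hy) (k.cast_nonneg (α := ℝ))
    linarith
  -- Here the approximation goes from `Γ` to `G`: a point of `G` near `y` bounds the expected cross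
  -- term in direction `-v` from below.
  obtain ⟨q, hq, hqy⟩ := exists_inner_le_add_hausdorffDist hΓ hG hGne hy (-v)
  rw [Metric.hausdorffDist_comm, norm_neg] at hqy
  set δ := Metric.hausdorffDist G Γ
  have hδ : 0 ≤ δ := Metric.hausdorffDist_nonneg
  have hsup : inner ℝ q (-v) ≤ S.expect (fun ω => inner ℝ (X ω) (-v)) :=
    (hGX (-v)).1 ⟨q, hq, rfl⟩
  have hI := hX.comp_mem (IsQuadLip.inner_left (-v))
  have hN := hX.comp_mem IsQuadLip.norm_sq
  have hT := hX.comp_mem ((IsQuadLip.norm_sub_sq (((k + 1 : ℕ) : ℝ) • y)).neg.comp_add_left a)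
  have hpt : ∀ ω, (-‖v‖ ^ 2 - 2 * inner ℝ y (-v) - 2 * R ^ 2) + 2 * inner ℝ (X ω) (-v) ≤
      -‖a + X ω - ((k + 1 : ℕ) : ℝ) • y‖ ^ 2 + (0 + 2 * ‖X ω‖ ^ 2) := by
    intro ω
    have h1 : a + X ω - ((k + 1 : ℕ) : ℝ) • y = v + (X ω - y) := by
      rw [hv]
      push_cast
      rw [add_smul, one_smul]
      abel
    rw [h1, norm_add_sq_real, inner_sub_right, real_inner_comm (X ω) v, real_inner_comm y v,
      inner_neg_right, inner_neg_right]
    have h3 := norm_sub_sq_le_two_mul (X ω) (hR y hy)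
    linarith
  have hstep := S.expect_mono (S.affine_mem _ 2 hI) (S.add_mem hT (S.affine_mem 0 2 hN)) hpt
  have hadd := S.expect_add_le hT (S.affine_mem 0 2 hN)
  have h4 := S.le_expect_affine (-‖v‖ ^ 2 - 2 * inner ℝ y (-v) - 2 * R ^ 2) zero_le_two hI
  have h5 := S.expect_affine_le 0 zero_le_two hN
  have h6 := mul_le_mul_of_nonneg_left hvn hδ
  linarith

end SublinearExpectationSpace

/-! ### From quadratic bounds to Lipschitz test functions -/

theorem sum_range_add_mul_le {δ : ℕ → ℝ} (hδ : ∀ k, 0 ≤ δ k) {C R A : ℝ} (hR : 0 ≤ R)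
    (hA : 0 ≤ A) (n : ℕ) :
    ∑ k ∈ Finset.range n, ((C + 2 * δ k * (k * R)) + 2 * δ k * (k * A)) ≤
      n * C + 2 * (R + A) * (n * ∑ k ∈ Finset.range n, δ k) := by
  calc ∑ k ∈ Finset.range n, ((C + 2 * δ k * (k * R)) + 2 * δ k * (k * A))
      ≤ ∑ k ∈ Finset.range n, (C + 2 * (R + A) * (n * δ k)) := by
        refine Finset.sum_le_sum fun k hk => ?_
        have h1 : (k : ℝ) ≤ n := by exact_mod_cast (Finset.mem_range.1 hk).le
        have h2 : (k : ℝ) * δ k ≤ n * δ k := mul_le_mul_of_nonneg_right h1 (hδ k)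
        nlinarith [mul_le_mul_of_nonneg_left h2 (add_nonneg hR hA)]
    _ = _ := by
        rw [Finset.sum_add_distrib, ← Finset.mul_sum, ← Finset.mul_sum]
        simp

/-- Replaces the Cauchy–Schwarz inequality when passing from second to first moments. -/
theorem le_add_sq_div {t ε : ℝ} (hε : 0 < ε) : t ≤ ε + t ^ 2 / ε := by
  rw [← sub_nonneg]
  have : ε + t ^ 2 / ε - t = ((t - ε / 2) ^ 2 + 3 / 4 * ε ^ 2) / ε := by field_simp; ring
  rw [this]
  positivity

namespace SublinearExpectationSpace

variable {Ω : Type*} {S : SublinearExpectationSpace Ω} {d : ℕ}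

/-- Rate form of the law of large numbers: if `n² e` bounds the upper expectation of the squared
distance of `Z` to `nΓ` and the lower expectation of its squared distance to `ny`, where `y`
maximizes `φ` over `Γ`, then `E[φ(Z / n)]` is within `2 K √e` of `φ y`. -/
theorem abs_expect_sub_isGreatest_le {Z : Ω → EuclideanSpace ℝ (Fin d)} (hZ : S.IsRandomVector Z)
    {Γ : Set (EuclideanSpace ℝ (Fin d))} (hΓ : IsCompact Γ)
    {φ : EuclideanSpace ℝ (Fin d) → ℝ} {K : NNReal} (hφ : LipschitzWith K φ)
    {y : EuclideanSpace ℝ (Fin d)} (hy : y ∈ Γ) (hmax : ∀ z ∈ Γ, φ z ≤ φ y)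
    {n : ℕ} (hn : 0 < n) {e : ℝ} (he : 0 < e)
    (hU : S.expect (fun ω => Metric.infDist (Z ω) ((n : ℝ) • Γ) ^ 2) ≤ n ^ 2 * e)
    (hL : -(n ^ 2 * e) ≤ S.expect (fun ω => -‖Z ω - (n : ℝ) • y‖ ^ 2)) :
    |S.expect (fun ω => φ ((1 / (n : ℝ)) • Z ω)) - φ y| ≤ 2 * K * √e := by
  have hn' : (0 : ℝ) < n := by exact_mod_cast hn
  set ε := √e with hεdef
  have hε : 0 < ε := Real.sqrt_pos.2 he
  have hεe : e = ε ^ 2 := (Real.sq_sqrt he.le).symm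
  have hlip : ∀ x z, |φ x - φ z| ≤ K * ‖x - z‖ := fun x z => by
    simpa [Real.dist_eq, dist_eq_norm] using hφ.dist_le_mul x z
  have hscale : ∀ x z : EuclideanSpace ℝ (Fin d),
      ‖(1 / (n : ℝ)) • x - z‖ = ‖x - (n : ℝ) • z‖ / n := fun x z => by
    have : (1 / (n : ℝ)) • x - z = (1 / (n : ℝ)) • (x - (n : ℝ) • z) := by
      rw [smul_sub, smul_smul, one_div_mul_cancel hn'.ne', one_smul]
    rw [this, norm_smul, norm_div, norm_one, RCLike.norm_natCast]
    ring
  have hφmem : (fun ω => φ ((1 / (n : ℝ)) • Z ω)) ∈ S.H := by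
    refine hZ.comp_mem (f := fun x => φ ((1 / (n : ℝ)) • x))
      (IsQuadLip.of_abs_sub_le (K := K * (1 / (n : ℝ))) fun x z => ?_)
    refine (hlip _ _).trans_eq ?_
    rw [← smul_sub, norm_smul, norm_div, norm_one, RCLike.norm_natCast]
    ring
  have hr : (0 : ℝ) ≤ K / (n ^ 2 * ε) := by positivity
  -- With `ε = √e`, a second moment of size `n² e` makes both terms equal to `K ε`; this is the
  -- source of the factor `2`.
  have hbound : ∀ t : ℝ, K * (t / n) ≤ K * ε + K / (n ^ 2 * ε) * t ^ 2 := fun t => by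
    refine (mul_le_mul_of_nonneg_left (le_add_sq_div (t := t / n) hε) K.2).trans_eq ?_
    simp only [NNReal.val_eq_coe]
    field_simp
  have hscaled : K / (n ^ 2 * ε) * (n ^ 2 * e) = K * ε := by
    rw [hεe]
    field_simp
  have hD := hZ.comp_mem (IsQuadLip.infDist_sq ((n : ℝ) • Γ))
  have hN := hZ.comp_mem (IsQuadLip.norm_sub_sq ((n : ℝ) • y)).neg
  -- Compare with `z ∈ Γ`, where `n z` is a nearest point of `nΓ` to `Z ω`.
  have hup := (S.expect_mono hφmem (S.affine_mem (φ y + K * ε) (K / (n ^ 2 * ε)) hD) fun ω => by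
    obtain ⟨p, ⟨z, hz, rfl⟩, hpd⟩ :=
      (hΓ.smul (n : ℝ)).exists_infDist_eq_dist (Set.Nonempty.smul_set ⟨y, hy⟩) (Z ω)
    simp only [dist_eq_norm] at hpd
    have h1 := (abs_le.1 (hlip ((1 / (n : ℝ)) • Z ω) z)).2
    rw [hscale] at h1
    have h2 := hbound ‖Z ω - (n : ℝ) • z‖
    rw [hpd]
    linarith [hmax z hz]).trans (S.expect_affine_le _ hr hD)
  have hlow := (S.le_expect_affine (φ y - K * ε) hr hN).trans
    (S.expect_mono (S.affine_mem _ _ hN) hφmem fun ω => by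
      have h1 := (abs_le.1 (hlip ((1 / (n : ℝ)) • Z ω) y)).1
      rw [hscale] at h1
      have h2 := hbound ‖Z ω - (n : ℝ) • y‖
      linarith)
  have h3 := mul_le_mul_of_nonneg_left hU hr
  have h4 := mul_le_mul_of_nonneg_left hL hr
  rw [abs_le]
  constructor <;> linarith

/-! ### Existence of the maximal distribution -/

/-- The sublinear expectation `sup_Γ` on the continuous functions on `ℝ^d`. -/
noncomputable def ofCompact {Γ : Set (EuclideanSpace ℝ (Fin d))} (hΓ : IsCompact Γ)
    (hne : Γ.Nonempty) : SublinearExpectationSpace (EuclideanSpace ℝ (Fin d)) where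
  H :=
    { carrier := {f | Continuous f}
      add_mem' := fun hf hg => Continuous.add hf hg
      zero_mem' := continuous_const
      smul_mem' := fun c _ hf => Continuous.const_smul hf c }
  const_mem _ := continuous_const
  abs_mem _ hX := Continuous.abs hX
  comp_mem n X hX φ hφ := by
    have hφc : Continuous φ := by
      obtain ⟨C, -, m, h⟩ := hφ
      refine continuous_iff_continuousAt.2 fun x => ?_
      rw [ContinuousAt, tendsto_iff_dist_tendsto_zero]
      have hlim : Filter.Tendsto (fun z => C * (1 + ‖z‖ ^ m + ‖x‖ ^ m) * ‖z - x‖) (nhds x)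
          (nhds 0) := by
        have : Continuous fun z => C * (1 + ‖z‖ ^ m + ‖x‖ ^ m) * ‖z - x‖ := by fun_prop
        simpa using this.tendsto x
      exact squeeze_zero (fun _ => dist_nonneg) (fun z => h z x) hlim
    have hXc : ∀ k, Continuous (X k) := hX
    change Continuous fun ω => φ (WithLp.toLp 2 fun k => X k ω)
    fun_prop
  E X := sSup ((X : EuclideanSpace ℝ (Fin d) → ℝ) '' Γ)
  mono X Y h := by
    refine csSup_le (hne.image _) ?_
    rintro _ ⟨z, hz, rfl⟩
    exact (h z).trans (le_csSup (hΓ.bddAbove_image (Continuous.continuousOn X.2)) ⟨z, hz, rfl⟩)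
  const_preserving c := by simp [hne.image_const]
  subadditive X Y := by
    refine csSup_le (hne.image _) ?_
    rintro _ ⟨z, hz, rfl⟩
    exact add_le_add
      (le_csSup (hΓ.bddAbove_image (Continuous.continuousOn X.2)) ⟨z, hz, rfl⟩)
      (le_csSup (hΓ.bddAbove_image (Continuous.continuousOn Y.2)) ⟨z, hz, rfl⟩)
  pos_homogeneous r X hr := by
    rw [← smul_eq_mul, ← Real.sSup_smul_of_nonneg hr, ← Set.image_smul, Set.image_image]
    rfl

theorem isMaximalDistributed_ofCompact {Γ : Set (EuclideanSpace ℝ (Fin d))} (hΓ : IsCompact Γ)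
    (hne : Γ.Nonempty) (hconv : Convex ℝ Γ) :
    (ofCompact hΓ hne).IsMaximalDistributed id Γ := by
  refine ⟨fun j => ?_, hΓ.isBounded, hconv, hΓ.isClosed, fun φ hφ => ?_⟩
  · change Continuous fun ω : EuclideanSpace ℝ (Fin d) => ω j
    fun_prop
  · obtain ⟨-, K, hK⟩ := hφ
    have hmem : φ ∈ (ofCompact hΓ hne).H := hK.continuous
    simp only [id]
    rw [expect_of_mem _ hmem]
    exact (hΓ.image hK.continuous).isGreatest_sSup (hne.image _)

end SublinearExpectationSpace

/-! ### The law of large numbers -/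

theorem corollary5p6 {Ω : Type*} (S : SublinearExpectationSpace Ω) {d : ℕ}
    -- `Y i` is the `(i+1)`-st member of the sequence
    (Y : ℕ → Ω → EuclideanSpace ℝ (Fin d))
    (hY : ∀ i, S.IsRandomVector (Y i))
    (hindep : ∀ i : ℕ, S.IndepFrom (Y (i + 1)) (fun ω (k : Fin (i + 1)) => Y k ω))
    (M : ℝ) (hM : 0 < M)
    (hmoment : ∀ i, S.expect (fun ω => ‖Y i ω‖ ^ 2) ≤ M)
    (Γi : ℕ → Set (EuclideanSpace ℝ (Fin d)))
    (hΓi_bdd : ∀ i, Bornology.IsBounded (Γi i))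
    (hΓi_convex : ∀ i, Convex ℝ (Γi i))
    (hΓi_closed : ∀ i, IsClosed (Γi i))
    (hΓi : ∀ i (p : EuclideanSpace ℝ (Fin d)),
      IsLUB ((fun q => inner ℝ q p) '' Γi i) (S.expect fun ω => inner ℝ (Y i ω) p))
    (Γ : Set (EuclideanSpace ℝ (Fin d)))
    (hΓ_nonempty : Γ.Nonempty)
    (hΓ_bdd : Bornology.IsBounded Γ)
    (hΓ_convex : Convex ℝ Γ)
    (hΓ_closed : IsClosed Γ)
    (hlim : Filter.Tendsto
      (fun n : ℕ => (1 / (n : ℝ)) * ∑ i ∈ Finset.range n, Metric.hausdorffDist (Γi i) Γ)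
      Filter.atTop (nhds 0)) :
    -- the maximal distribution over `Γ` exists
    (∃ (Ω' : Type) (S' : SublinearExpectationSpace Ω') (η : Ω' → EuclideanSpace ℝ (Fin d)),
      S'.IsMaximalDistributed η Γ) ∧
    -- and `S_n / n` converges in law to it, however it is realized
    (∀ (Ω' : Type*) (S' : SublinearExpectationSpace Ω') (η : Ω' → EuclideanSpace ℝ (Fin d)),
      S'.IsMaximalDistributed η Γ →
      ∀ φ : EuclideanSpace ℝ (Fin d) → ℝ, IsBddLip φ →
        Filter.Tendsto
          (fun n : ℕ => S.expect fun ω => φ ((1 / (n : ℝ)) • ∑ i ∈ Finset.range n, Y i ω))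
          Filter.atTop (nhds (S'.expect fun ω => φ (η ω)))) := by
  have hΓ : IsCompact Γ := Metric.isCompact_of_isClosed_isBounded hΓ_closed hΓ_bdd
  refine ⟨⟨_, SublinearExpectationSpace.ofCompact hΓ hΓ_nonempty, id,
    SublinearExpectationSpace.isMaximalDistributed_ofCompact hΓ hΓ_nonempty hΓ_convex⟩, ?_⟩
  rintro Ω' S' η ⟨-, -, -, -, hη⟩ φ hφ
  obtain ⟨⟨y, hy, hyφ⟩, hmax⟩ := hη φ hφ
  rw [← hyφ] at hmax ⊢
  obtain ⟨-, K, hK⟩ := hφ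
  obtain ⟨R, hR0, hR⟩ := hΓ_bdd.exists_pos_norm_le
  have hA : ∀ i, S.expect (fun ω => ‖Y i ω‖) ≤ 1 + M := fun i =>
    SublinearExpectationSpace.expect_norm_le (hY i) (hmoment i)
  set δ : ℕ → ℝ := fun k => Metric.hausdorffDist (Γi k) Γ
  have hδ : ∀ k, 0 ≤ δ k := fun k => Metric.hausdorffDist_nonneg
  have hδ2 : ∀ k, 0 ≤ 2 * δ k := fun k => mul_nonneg zero_le_two (hδ k)
  set C := 2 * R ^ 2 + 2 * M with hC
  have hC0 : 0 < C := by positivity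
  -- The accumulated one-step errors divided by `n²`. The term `C / n` also keeps `e n` positive for
  -- `n > 0`.
  let e : ℕ → ℝ := fun n =>
    C * (1 / (n : ℝ)) + 2 * (R + (1 + M)) * ((1 / (n : ℝ)) * ∑ i ∈ Finset.range n, δ i)
  have he : Filter.Tendsto e Filter.atTop (nhds 0) := by
    simpa only [mul_zero, add_zero] using (tendsto_one_div_atTop_nhds_zero_nat.const_mul C).add
      (hlim.const_mul (2 * (R + (1 + M))))
  have hsqrt : Filter.Tendsto (fun n => 2 * (K : ℝ) * √(e n)) Filter.atTop (nhds 0) := by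
    simpa using he.sqrt.const_mul (2 * (K : ℝ))
  rw [tendsto_iff_dist_tendsto_zero]
  refine squeeze_zero' (Filter.Eventually.of_forall fun _ => dist_nonneg) ?_ hsqrt
  filter_upwards [Filter.eventually_gt_atTop 0] with n hn
  have hn' : (0 : ℝ) < n := by exact_mod_cast hn
  have hsum : ∑ k ∈ Finset.range n, ((C + 2 * δ k * (k * R)) + 2 * δ k * (k * (1 + M))) ≤
      n ^ 2 * e n := by
    refine (sum_range_add_mul_le hδ hR0.le (by linarith) n).trans_eq ?_
    simp only [e]
    field_simp
  have hen : 0 < e n :=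
    add_pos_of_pos_of_nonneg (by positivity)
      (mul_nonneg (by positivity) (mul_nonneg (by positivity) (Finset.sum_nonneg fun k _ => hδ k)))
  refine SublinearExpectationSpace.abs_expect_sub_isGreatest_le
    (SublinearExpectationSpace.IsRandomVector.sum hY n) hΓ hK hy
    (fun z hz => hmax ⟨z, hz, rfl⟩) hn hen ?_ ?_
  · have h := SublinearExpectationSpace.expect_sum_le_of_step hY hindep hA
      (f := fun k x => Metric.infDist x ((k : ℝ) • Γ) ^ 2)
      (fun k => IsQuadLip.infDist_sq _) hδ2
      (fun k a => SublinearExpectationSpace.expect_infDist_sq_le (hY k) (hmoment k)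
        (hΓi_bdd k) (hΓi k) hΓ_nonempty hΓ hΓ_convex hR k a) n
    -- The initial value vanishes because `0 • Γ = {0}`.
    simp only [Nat.cast_zero, Set.zero_smul_set hΓ_nonempty] at h
    rw [Metric.infDist_zero_of_mem (Set.mem_zero.2 rfl)] at h
    linarith
  · have h := SublinearExpectationSpace.le_expect_sum_of_step hY hindep hA
      (f := fun k x => -‖x - (k : ℝ) • y‖ ^ 2)
      (fun k => (IsQuadLip.norm_sub_sq _).neg) hδ2
      (fun k a => SublinearExpectationSpace.le_expect_neg_norm_sub_sq (hY k) (hmoment k)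
        (Metric.isCompact_of_isClosed_isBounded (hΓi_closed k) (hΓi_bdd k)) (hΓi k)
        hΓ_bdd hR hy k a) n
    simp only [Nat.cast_zero, zero_smul, sub_zero, norm_zero] at h
    linarith
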